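/- Let $M=\{0,1\}^{\mathbb N}$ with the metric $d(x,y)=2^{-N(x,y)}$, where $N(x,y)$ is the first index at which $x\neq y$ differ, and let $\sigma$ be the left shift on $M$. Let $A:M\to\mathbb R$ be Hölder continuous of exponent $s>0$ and normalized, i.e. $\mathcal L_A 1=1$, where $\mathcal L_A f(x)=\sum_{\sigma(y)=x}e^{A(y)}f(y)$ is the Ruelle operator. Let $\mu=\mu_A$ be the equilibrium probability of $A$: the $\sigma$-invariant Borel probability with $\mathcal L_A^*\mu=\mu$, i.e. $\int \mathcal L_A f\,d\mu=\int f\,d\mu$ for all continuous $f$. Then there exist constants $\alpha,\beta>0$ and continuous functions $e_n:M\to\mathbb R$, $n\in\mathbb N$, such that 1. each $e_n$ lies in $T_A\mathcal N$, i.e. $e_n$ is Hölder continuous of exponent $s$ and $\mathcal L_A e_n=0$ everywhere on $M$; 2. $(e_n)$ is an orthonormal Hilbert basis of the kernel of the Ruelle operator: it is orthonormal in the real space $L^2(\mu)$, and the closure of its linear span in $L^2(\mu)$ equals $\{f\in L^2(\mu):\mathcal L_A f=0\ \mu\text{-a.e.}\}$; 3. $\alpha\le\|e_n\|_{C^0}\le\beta$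 and $\alpha\le\|e_n\|_{L^2(\mu)}\le\beta$ for every $n$. -/

import Mathlib

open MeasureTheory Topology

noncomputable section

/-- The symbolic space `{0,1}^ℕ`, with the product topology and its Borel σ-algebra. -/
abbrev BinSeq : Type := ℕ → Fin 2

/-- The left shift `σ (x₀, x₁, x₂, …) = (x₁, x₂, …)`. -/
def binShift (x : BinSeq) : BinSeq := fun n => x (n + 1)

/-- The sequence `(i, x₀, x₁, …)`. -/
def binCons (i : Fin 2) (x : BinSeq) : BinSeq
  | 0 => i
  | n + 1 => x n

/-- `f` is Hölder continuous of exponent `s` for the usual metric of `{0,1}^ℕ`: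
`PiNat.dist` is `d(x, y) = 2 ^ (-N)`, with `N` the first index at which `x` and `y` differ. -/
def IsHolder (s : ℝ) (f : BinSeq → ℝ) : Prop :=
  ∃ C : ℝ, ∀ x y : BinSeq, |f x - f y| ≤ C * (@dist BinSeq PiNat.dist x y) ^ s

/-- The Ruelle operator `(L_A f)(x) = ∑_{σ(y) = x} e^{A(y)} f(y)`; the sum has two terms, see
`ruelle_apply`. -/
def ruelle (A f : BinSeq → ℝ) (x : BinSeq) : ℝ :=
  ∑ᶠ y ∈ {y | binShift y = x}, Real.exp (A y) * f y

/-- The potential `A` is normalized: `L_A 1 = 1`. -/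
def IsNormalized (A : BinSeq → ℝ) : Prop := ∀ x, ruelle A (fun _ => 1) x = 1

/-- The probability `μ` is the equilibrium (Gibbs) probability of the normalized potential `A`:
it is invariant under the shift and fixed by the dual of the Ruelle operator,
`∫ L_A f dμ = ∫ f dμ` for all continuous `f`. -/
structure IsEquilibrium (A : BinSeq → ℝ) (μ : Measure BinSeq) : Prop where
  invariant : MeasurePreserving binShift μ μ
  dual_eq : ∀ f : C(BinSeq, ℝ), ∫ x, ruelle A f x ∂μ = ∫ x, f x ∂μ

/-- The tangent space `T_A N`: the functions in the kernel of the Ruelle operator `L_A` that are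
Hölder continuous of exponent `s`. -/
def tangentSpaceAt (s : ℝ) (A : BinSeq → ℝ) : Set (BinSeq → ℝ) :=
  {f | IsHolder s f ∧ ∀ x, ruelle A f x = 0}

/-- The kernel of the Ruelle operator `L_A` acting on `L²(μ)`. By `ruelle_congr_ae` it does not
depend on the representatives when `μ` is the equilibrium probability of `A`. -/
def ruelleKernel (A : BinSeq → ℝ) (μ : Measure BinSeq) : Set (Lp ℝ 2 μ) :=
  {f | ruelle A f =ᵐ[μ] 0}

theorem ruelle_apply (A f : BinSeq → ℝ) (x : BinSeq) :
    ruelle A f x = Real.exp (A (binCons 0 x)) * f (binCons 0 x)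
      + Real.exp (A (binCons 1 x)) * f (binCons 1 x) := by
  have h : {y | binShift y = x} = {binCons 0 x, binCons 1 x} := by
    ext y
    simp only [Set.mem_ofPred_eq, Set.mem_insert_iff, Set.mem_singleton_iff]
    constructor
    · rintro rfl
      have key : ∀ i, y 0 = i → y = binCons i (binShift y) := by
        rintro i rfl
        funext n
        cases n <;> rfl
      match h : y 0 with
      | 0 => exact Or.inl (key 0 h)
      | 1 => exact Or.inr (key 1 h)
    · rintro (rfl | rfl) <;> rfl
  have hne : binCons 0 x ≠ binCons 1 x := fun h => by
    simpa [binCons] using congrFun h 0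
  rw [ruelle, h, finsum_mem_pair hne]

theorem continuous_binCons (i : Fin 2) : Continuous (binCons i) := by
  refine continuous_pi fun n => ?_
  cases n with
  | zero => exact continuous_const
  | succ n => exact continuous_apply n

theorem IsHolder.continuous {s : ℝ} (hs : 0 < s) {f : BinSeq → ℝ} (hf : IsHolder s f) :
    Continuous f := by
  obtain ⟨C, hC⟩ := hf
  letI : MetricSpace BinSeq := PiNat.metricSpace (E := fun _ : ℕ => Fin 2)
  rw [continuous_iff_continuousAt]
  intro x
  rw [ContinuousAt, tendsto_iff_dist_tendsto_zero]
  have h1 : Filter.Tendsto (fun y : BinSeq => C * (dist y x) ^ s) (𝓝 x) (𝓝 (C * 0 ^ s)) := by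
    have h2 : Filter.Tendsto (fun y : BinSeq => dist y x) (𝓝 x) (𝓝 0) :=
      tendsto_iff_dist_tendsto_zero.1 Filter.tendsto_id
    exact (h2.rpow_const (Or.inr hs.le)).const_mul C
  rw [Real.zero_rpow hs.ne', mul_zero] at h1
  exact squeeze_zero (fun _ => dist_nonneg) (fun y => hC y x) h1

theorem ruelle_congr_ae {A : BinSeq → ℝ} (hA : Continuous A) {μ : Measure BinSeq}
    [IsProbabilityMeasure μ] (hμ : IsEquilibrium A μ) {f g : BinSeq → ℝ} (h : f =ᵐ[μ] g) :
    ruelle A f =ᵐ[μ] ruelle A g := by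
  have hw : ∀ i, Continuous fun x => Real.exp (A (binCons i x)) := fun i =>
    Real.continuous_exp.comp (hA.comp (continuous_binCons i))
  have hwi : ∀ i, Integrable (fun x => Real.exp (A (binCons i x))) μ := fun i =>
    (BoundedContinuousFunction.mkOfCompact ⟨_, hw i⟩).integrable μ
  let w : Fin 2 → BinSeq → ENNReal := fun i x => ENNReal.ofReal (Real.exp (A (binCons i x)))
  have hwm : ∀ i, Measurable (w i) := fun i => (hw i).measurable.ennreal_ofReal
  have hfin : ∀ i, IsFiniteMeasure (μ.withDensity (w i)) := fun i =>
    isFiniteMeasure_withDensity_ofReal (hwi i).2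
  have hcm : ∀ i, Measurable (binCons i) := fun i => (continuous_binCons i).measurable
  have hν : ((μ.withDensity (w 0)).map (binCons 0) + (μ.withDensity (w 1)).map (binCons 1)) = μ := by
    refine ext_of_forall_integral_eq_of_IsFiniteMeasure fun φ => ?_
    have e : ∀ i, ∫ x, φ x ∂((μ.withDensity (w i)).map (binCons i))
        = ∫ x, Real.exp (A (binCons i x)) * φ (binCons i x) ∂μ := by
      intro i
      rw [integral_map (hcm i).aemeasurable φ.continuous.aestronglyMeasurable,
        integral_withDensity_eq_integral_toReal_smul (hwm i)
          (Filter.Eventually.of_forall fun _ => ENNReal.ofReal_lt_top)]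
      simp [w, ENNReal.toReal_ofReal, (Real.exp_pos _).le]
    have hi : ∀ i, Integrable (fun x => Real.exp (A (binCons i x)) * φ (binCons i x)) μ := fun i =>
      (BoundedContinuousFunction.mkOfCompact
        ⟨_, (hw i).mul (φ.continuous.comp (continuous_binCons i))⟩).integrable μ
    rw [integral_add_measure (φ.integrable _) (φ.integrable _), e 0, e 1,
      ← integral_add (hi 0) (hi 1), ← show _ = ∫ x, φ x ∂μ from hμ.dual_eq φ.toContinuousMap]
    simp only [ruelle_apply]
    rfl
  have key : ∀ i, (∀ᵐ x ∂((μ.withDensity (w i)).map (binCons i)), f x = g x) →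
      ∀ᵐ x ∂μ, f (binCons i x) = g (binCons i x) := by
    intro i hi
    have h1 := ae_of_ae_map (hcm i).aemeasurable hi
    rw [ae_withDensity_iff (hwm i)] at h1
    filter_upwards [h1] with x hx
    exact hx (by simp [w, Real.exp_pos])
  rw [← hν] at h
  have h' := ae_add_measure_iff.1 h
  filter_upwards [key 0 h'.1, key 1 h'.2] with x h0 h1
  rw [ruelle_apply, ruelle_apply, h0, h1]

end

/-!
The basis is obtained from a general principle of Olevskii and of Ovsepian and Pełczyński: a
separable space of bounded functions that contains one infinite uniformly bounded orthonormal
sequence has a uniformly bounded orthonormal basis (`exists_bounded_orthonormal_basis`).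

A function `f` of norm one in `L²(μ)` but of large sup norm is repaired by rotations. If `g` is
orthogonal to `f` and has norm one and moderate sup norm, then `f` is in the span of `(f ± g) / √2`,
whose sup norms are smaller by a fixed factor; repeating this with both halves and with fresh
functions `g` brings all the sup norms below a fixed bound (`exists_bounded_splitting`). Fresh
functions exist orthogonally to any finite orthonormal set, since by Bessel's inequality the given
uniformly bounded sequence is almost orthogonal to it in the long run
(`exists_fresh_unit_vector`). A dense sequence is treated in this way, one term after the other.

In the kernel of the Ruelle operator the uniformly bounded sequence is explicit
(`IsEquilibrium.exists_bounded_orthonormal`). There is a Hölder function `φ = kernelUnit A` with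
`L_A φ = 0` and `L_A (φ²) = 1`; as `L_A (f * h ∘ σ) = h * L_A f`, the functions `φ * φ ∘ σ ^ (m + 1)`
are in the kernel, and they are orthonormal.

Finally, the Hölder functions of the kernel are dense in it
(`IsEquilibrium.eq_ruelleKernelSubmodule`), since the kernel is the orthogonal complement of the
functions `h ∘ σ`, and `f - (L_A f) ∘ σ` is in the kernel for every Hölder function `f`.
-/

/-! ### Uniformly bounded orthonormal bases -/

section BoundedBasis

variable {E H : Type*} [NormedAddCommGroup E] [NormedSpace ℝ E]
  [NormedAddCommGroup H] [InnerProductSpace ℝ H]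

/-- The finite set `D ⊆ E` is mapped injectively by `T` to an orthonormal set. -/
def OrthonormalImage (T : E →L[ℝ] H) (D : Finset E) : Prop :=
  (∀ x ∈ D, ‖T x‖ = 1) ∧ ∀ x ∈ D, ∀ y ∈ D, x ≠ y → inner ℝ (T x) (T y) = 0

theorem OrthonormalImage.insert [DecidableEq E] {T : E →L[ℝ] H} {D : Finset E}
    (hD : OrthonormalImage T D) {f : E} (hf : ‖T f‖ = 1)
    (hfD : ∀ d ∈ D, inner ℝ (T d) (T f) = 0) : OrthonormalImage T (insert f D) := by
  refine ⟨fun x hx => ?_, fun x hx y hy hxy => ?_⟩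
  · rcases Finset.mem_insert.1 hx with rfl | hx
    exacts [hf, hD.1 x hx]
  · rcases Finset.mem_insert.1 hx with rfl | hx' <;> rcases Finset.mem_insert.1 hy with rfl | hy'
    · exact absurd rfl hxy
    · rw [real_inner_comm]; exact hfD y hy'
    · exact hfD x hx'
    · exact hD.2 x hx' y hy' hxy

theorem OrthonormalImage.union [DecidableEq E] {T : E →L[ℝ] H} {D R : Finset E}
    (hD : OrthonormalImage T D) (hR : OrthonormalImage T R)
    (h : ∀ d ∈ D, ∀ x ∈ R, inner ℝ (T d) (T x) = 0) : OrthonormalImage T (D ∪ R) := by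
  refine ⟨fun x hx => ?_, fun x hx y hy hxy => ?_⟩
  · rcases Finset.mem_union.1 hx with hx | hx
    exacts [hD.1 x hx, hR.1 x hx]
  · rcases Finset.mem_union.1 hx with hx' | hx' <;> rcases Finset.mem_union.1 hy with hy' | hy'
    · exact hD.2 x hx' y hy' hxy
    · exact h x hx' y hy'
    · rw [real_inner_comm]; exact h y hy' x hx'
    · exact hR.2 x hx' y hy' hxy

theorem OrthonormalImage.inner_residual {T : E →L[ℝ] H} {D : Finset E}
    (hD : OrthonormalImage T D) (f : E) {d : E} (hd : d ∈ D) :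
    inner ℝ (T d) (T (f - ∑ c ∈ D, (inner ℝ (T c) (T f)) • c)) = 0 := by
  rw [map_sub, map_sum, inner_sub_right, inner_sum, Finset.sum_eq_single_of_mem d hd]
  · rw [map_smul, inner_smul_right, real_inner_self_eq_norm_sq, hD.1 d hd]; ring
  · intro c hc hcd
    rw [map_smul, inner_smul_right, hD.2 d hd c hc hcd.symm, mul_zero]

/-- By Bessel's inequality the residuals of a bounded orthonormal sequence with respect to a finite
orthonormal set differ little from the sequence itself, even in the norm of `E`. -/
theorem exists_fresh_unit_vector {T : E →L[ℝ] H} {g : ℕ → E} {B : ℝ}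
    (hg : Orthonormal ℝ fun m => T (g m)) (hB : ∀ m, ‖g m‖ ≤ B) {D : Finset E}
    (hD : OrthonormalImage T D) :
    ∃ x : E, ‖x‖ ≤ 2 * (B + 1) ∧ ‖T x‖ = 1 ∧ ∀ d ∈ D, inner ℝ (T d) (T x) = 0 := by
  let q : ℕ → E := fun m => ∑ c ∈ D, (inner ℝ (T c) (T (g m))) • c
  have hq : Filter.Tendsto q Filter.atTop (𝓝 0) := by
    have : Filter.Tendsto q Filter.atTop (𝓝 (∑ c ∈ D, (0 : ℝ) • c)) := by
      refine tendsto_finsetSum _ fun c _ => Filter.Tendsto.smul_const ?_ c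
      have h1 := (hg.inner_products_summable (T c)).tendsto_atTop_zero
      have h2 := h1.sqrt
      simp only [Real.sqrt_zero, Real.norm_eq_abs, sq_abs, Real.sqrt_sq_eq_abs] at h2
      have h3 := (tendsto_zero_iff_abs_tendsto_zero _).2 h2
      simpa only [real_inner_comm] using h3
    simpa using this
  have hTq : Filter.Tendsto (fun m => T (q m)) Filter.atTop (𝓝 0) := by
    simpa [Function.comp_def] using (T.continuous.tendsto 0).comp hq
  have h1 : ∀ᶠ m in Filter.atTop, ‖q m‖ < 1 := by
    simpa using hq.norm.eventually (gt_mem_nhds (by simp : ‖(0 : E)‖ < 1))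
  have h2 : ∀ᶠ m in Filter.atTop, ‖T (q m)‖ < 1 / 2 :=
    hTq.norm.eventually (gt_mem_nhds (by simp : ‖(0 : H)‖ < 1 / 2))
  obtain ⟨m, hm1, hm2⟩ := (h1.and h2).exists
  have hlow : 1 / 2 ≤ ‖T (g m - q m)‖ := by
    have := norm_sub_norm_le (T (g m)) (T (q m))
    rw [hg.1 m] at this
    rw [map_sub]; linarith
  have hpos : 0 < ‖T (g m - q m)‖ := by linarith
  refine ⟨‖T (g m - q m)‖⁻¹ • (g m - q m), ?_, ?_, fun d hd => ?_⟩
  · rw [norm_smul, norm_inv, norm_norm]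
    have h3 : ‖T (g m - q m)‖⁻¹ ≤ 2 := by
      rw [inv_le_comm₀ hpos two_pos]; simpa using hlow
    have h4 : ‖g m - q m‖ ≤ B + 1 := (norm_sub_le _ _).trans (add_le_add (hB m) hm1.le)
    exact mul_le_mul h3 h4 (norm_nonneg _) two_pos.le
  · rw [map_smul, norm_smul, norm_inv, norm_norm, inv_mul_cancel₀ hpos.ne']
  · rw [map_smul, inner_smul_right, hD.inner_residual (g m) hd, mul_zero]

/-- Splitting of a unit vector of large norm: `f` is rotated with a fresh vector `x` of norm at most
`C / 4` to `(f ± x) / √2`, which improves the bound `C * (10 / 9) ^ (n + 1)` on the norm to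
`C * (10 / 9) ^ n`; iterating, `f` is put into the span of an orthonormal set of vectors of norm at
most `C`. All new vectors are orthogonal to `D`, so that one half can be split without disturbing
the other. -/
theorem exists_bounded_splitting {T : E →L[ℝ] H} {C : ℝ}
    (hC : 0 ≤ C)
    (fresh : ∀ D : Finset E, OrthonormalImage T D →
      ∃ x : E, ‖x‖ ≤ C / 4 ∧ ‖T x‖ = 1 ∧ ∀ d ∈ D, inner ℝ (T d) (T x) = 0)
    (n : ℕ) : ∀ (D : Finset E) (f : E), OrthonormalImage T D → ‖T f‖ = 1 →
      (∀ d ∈ D, inner ℝ (T d) (T f) = 0) → ‖f‖ ≤ C * (10 / 9) ^ n →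
      ∃ R : Finset E, OrthonormalImage T R ∧ (∀ x ∈ R, ‖x‖ ≤ C) ∧
        (∀ d ∈ D, ∀ x ∈ R, inner ℝ (T d) (T x) = 0) ∧ T f ∈ Submodule.span ℝ (T '' R) := by
  classical
  induction n with
  | zero =>
    intro D f hD hf hfD hfn
    refine ⟨{f}, ⟨by simpa using hf, ?_⟩, by simpa using hfn, by simpa using hfD, ?_⟩
    · intro x hx y hy hxy
      exact absurd ((Finset.mem_singleton.1 hx).trans (Finset.mem_singleton.1 hy).symm) hxy
    · exact Submodule.subset_span ⟨f, by simp, rfl⟩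
  | succ n ih =>
    intro D f hD hf hfD hfn
    obtain ⟨x, hxC, hx, hxD⟩ := fresh _ (hD.insert hf hfD)
    have hfx : inner ℝ (T f) (T x) = 0 := hxD f (Finset.mem_insert_self _ _)
    have hxf : inner ℝ (T x) (T f) = 0 := by rw [real_inner_comm]; exact hfx
    have hxD' : ∀ d ∈ D, inner ℝ (T d) (T x) = 0 := fun d hd =>
      hxD d (Finset.mem_insert_of_mem hd)
    have hs : (√2 : ℝ)⁻¹ * (√2)⁻¹ = 1 / 2 := by
      rw [← mul_inv, Real.mul_self_sqrt (by norm_num)]; norm_num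
    set c : ℝ := (√2)⁻¹ with hc
    have hc0 : 0 < c := by positivity
    have hcl : c ≤ 72 / 100 := by nlinarith
    let v : E := c • (f + x)
    let w : E := c • (f - x)
    have hbd : c * (‖f‖ + ‖x‖) ≤ C * (10 / 9) ^ n := by
      have h1 : (1 : ℝ) ≤ (10 / 9) ^ n := one_le_pow₀ (by norm_num)
      have h2 : C ≤ C * (10 / 9) ^ n := le_mul_of_one_le_right hC h1
      rw [pow_succ] at hfn
      have h3 : c * (‖f‖ + ‖x‖) ≤ 72 / 100 * (‖f‖ + ‖x‖) :=
        mul_le_mul_of_nonneg_right hcl (by positivity)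
      linarith
    have hv : ‖v‖ ≤ C * (10 / 9) ^ n := by
      rw [norm_smul, Real.norm_of_nonneg hc0.le]
      exact (mul_le_mul_of_nonneg_left (norm_add_le _ _) hc0.le).trans hbd
    have hw : ‖w‖ ≤ C * (10 / 9) ^ n := by
      rw [norm_smul, Real.norm_of_nonneg hc0.le]
      exact (mul_le_mul_of_nonneg_left (norm_sub_le _ _) hc0.le).trans hbd
    have hff : inner ℝ (T f) (T f) = 1 := by rw [real_inner_self_eq_norm_sq, hf, one_pow]
    have hxx : inner ℝ (T x) (T x) = 1 := by rw [real_inner_self_eq_norm_sq, hx, one_pow]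
    have unit : ∀ y : E, inner ℝ (T y) (T y) = 1 → ‖T y‖ = 1 := fun y hy => by
      rw [real_inner_self_eq_norm_sq] at hy
      nlinarith [norm_nonneg (T y)]
    have hTv : ‖T v‖ = 1 := by
      apply unit
      simp only [v, map_smul, map_add, inner_smul_left, inner_smul_right, inner_add_left,
        inner_add_right, hff, hxx, hfx, hxf, conj_trivial]
      linear_combination 2 * hs
    have hTw : ‖T w‖ = 1 := by
      apply unit
      simp only [w, map_smul, map_sub, inner_smul_left, inner_smul_right, inner_sub_left,
        inner_sub_right, hff, hxx, hfx, hxf, conj_trivial]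
      linear_combination 2 * hs
    have hwv : inner ℝ (T w) (T v) = 0 := by
      simp only [v, w, map_smul, map_sub, map_add, inner_smul_left, inner_smul_right,
        inner_sub_left, inner_add_right, hff, hxx, hfx, hxf, conj_trivial]
      ring
    have hvD : ∀ d ∈ D, inner ℝ (T d) (T v) = 0 := fun d hd => by
      simp only [v, map_smul, map_add, inner_smul_right, inner_add_right, hfD d hd, hxD' d hd]
      ring
    have hwD : ∀ d ∈ D, inner ℝ (T d) (T w) = 0 := fun d hd => by
      simp only [w, map_smul, map_sub, inner_smul_right, inner_sub_right, hfD d hd, hxD' d hd]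
      ring
    obtain ⟨R, hR, hRC, hRD, hRv⟩ := ih (insert w D) v (hD.insert hTw hwD) hTv (by
      intro d hd
      rcases Finset.mem_insert.1 hd with rfl | hd
      exacts [hwv, hvD d hd]) hv
    have hRw : ∀ y ∈ R, inner ℝ (T y) (T w) = 0 := fun y hy => by
      rw [real_inner_comm]; exact hRD w (Finset.mem_insert_self _ _) y hy
    have hRD' : ∀ d ∈ D, ∀ y ∈ R, inner ℝ (T d) (T y) = 0 := fun d hd y hy =>
      hRD d (Finset.mem_insert_of_mem hd) y hy
    obtain ⟨Q, hQ, hQC, hQD, hQw⟩ := ih (D ∪ R) w (hD.union hR hRD') hTw (by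
      intro d hd
      rcases Finset.mem_union.1 hd with hd | hd
      exacts [hwD d hd, hRw d hd]) hw
    refine ⟨R ∪ Q, hR.union hQ fun y hy z hz => hQD y (Finset.mem_union_right _ hy) z hz, ?_, ?_, ?_⟩
    · intro y hy
      rcases Finset.mem_union.1 hy with hy | hy
      exacts [hRC y hy, hQC y hy]
    · intro d hd y hy
      rcases Finset.mem_union.1 hy with hy | hy
      exacts [hRD' d hd y hy, hQD d (Finset.mem_union_left _ hd) y hy]
    · have h1 : T v ∈ Submodule.span ℝ (T '' (R ∪ Q : Finset E)) :=
        Submodule.span_mono (Set.image_mono (by simp)) hRv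
      have h2 : T w ∈ Submodule.span ℝ (T '' (R ∪ Q : Finset E)) :=
        Submodule.span_mono (Set.image_mono (by simp)) hQw
      have h3 : T f = c • (T v + T w) := by
        simp only [v, w, map_smul, map_add, map_sub, ← smul_add, smul_smul, hs]
        module
      rw [h3]
      exact Submodule.smul_mem _ _ (Submodule.add_mem _ h1 h2)

/-- One step of the construction of the basis: a finite orthonormal set of vectors of norm at most
`C` is enlarged, keeping the bound, until its span contains a given vector. -/
theorem exists_bounded_extension {T : E →L[ℝ] H} {C : ℝ} (hC : 0 < C)
    (fresh : ∀ D : Finset E, OrthonormalImage T D →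
      ∃ x : E, ‖x‖ ≤ C / 4 ∧ ‖T x‖ = 1 ∧ ∀ d ∈ D, inner ℝ (T d) (T x) = 0)
    {D : Finset E} (hD : OrthonormalImage T D) (hDC : ∀ x ∈ D, ‖x‖ ≤ C) (f : E) :
    ∃ R : Finset E, D ⊂ R ∧ OrthonormalImage T R ∧ (∀ x ∈ R, ‖x‖ ≤ C) ∧
      T f ∈ Submodule.span ℝ (T '' R) := by
  classical
  -- A fresh vector is adjoined first, so that the extension is strict even if `T f` is already
  -- in the span.
  obtain ⟨x, hxC, hx, hxD⟩ := fresh D hD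
  have hxD0 : x ∉ D := fun h => by
    have := hxD x h
    rw [real_inner_self_eq_norm_sq, hx] at this
    norm_num at this
  have hS : OrthonormalImage T (insert x D) := hD.insert hx hxD
  have hSC : ∀ y ∈ insert x D, ‖y‖ ≤ C := by
    intro y hy
    rcases Finset.mem_insert.1 hy with rfl | hy
    exacts [by linarith, hDC y hy]
  have hss : D ⊂ insert x D := Finset.ssubset_insert hxD0
  set S := insert x D
  set r : E := f - ∑ c ∈ S, (inner ℝ (T c) (T f)) • c with hr
  have hTf : T f = T r + ∑ c ∈ S, (inner ℝ (T c) (T f)) • T c := by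
    simp [hr]
  have hsum : ∀ U : Finset E, S ⊆ U →
      ∑ c ∈ S, (inner ℝ (T c) (T f)) • T c ∈ Submodule.span ℝ (T '' U) := fun U hU =>
    Submodule.sum_mem _ fun c hc =>
      Submodule.smul_mem _ _ (Submodule.subset_span ⟨c, hU hc, rfl⟩)
  by_cases h0 : T r = 0
  · refine ⟨S, hss, hS, hSC, ?_⟩
    rw [hTf, h0, zero_add]
    exact hsum S subset_rfl
  have hn : ‖T r‖ ≠ 0 := norm_ne_zero_iff.2 h0
  let u : E := ‖T r‖⁻¹ • r
  have hTu : ‖T u‖ = 1 := by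
    rw [map_smul, norm_smul, norm_inv, norm_norm, inv_mul_cancel₀ hn]
  have huS : ∀ d ∈ S, inner ℝ (T d) (T u) = 0 := fun d hd => by
    rw [map_smul, inner_smul_right, hS.inner_residual f hd, mul_zero]
  obtain ⟨n, hn1⟩ := pow_unbounded_of_one_lt (‖u‖ / C) (by norm_num : (1 : ℝ) < 10 / 9)
  have hun : ‖u‖ ≤ C * (10 / 9) ^ n := by
    rw [div_lt_iff₀ hC] at hn1; linarith
  obtain ⟨R, hR, hRC, hRS, hRu⟩ := exists_bounded_splitting hC.le fresh n S u hS hTu huS hun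
  refine ⟨S ∪ R, hss.trans_subset Finset.subset_union_left, hS.union hR hRS, ?_, ?_⟩
  · intro y hy
    rcases Finset.mem_union.1 hy with hy | hy
    exacts [hSC y hy, hRC y hy]
  · rw [hTf]
    refine Submodule.add_mem _ ?_ (hsum _ Finset.subset_union_left)
    have h1 : T u ∈ Submodule.span ℝ (T '' (S ∪ R : Finset E)) :=
      Submodule.span_mono (Set.image_mono (by simp)) hRu
    have h2 : T r = ‖T r‖ • T u := by
      rw [map_smul, smul_smul, mul_inv_cancel₀ hn, one_smul]
    rw [h2]
    exact Submodule.smul_mem _ _ h1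

/-- If the image of `T` contains an infinite orthonormal sequence that lifts to a bounded sequence
of `E`, then the closure of the image has an orthonormal basis that lifts to a bounded sequence. -/
theorem exists_bounded_orthonormal_basis [TopologicalSpace.SeparableSpace E] {T : E →L[ℝ] H}
    {g : ℕ → E} {B : ℝ} (hg : Orthonormal ℝ fun m => T (g m)) (hB : ∀ m, ‖g m‖ ≤ B) :
    ∃ (C : ℝ) (e : ℕ → E), (∀ n, ‖e n‖ ≤ C) ∧ Orthonormal ℝ (fun n => T (e n)) ∧
      ∀ f, T f ∈ (Submodule.span ℝ (Set.range fun n => T (e n))).topologicalClosure := by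
  classical
  have hB0 : 0 ≤ B := (norm_nonneg _).trans (hB 0)
  set C : ℝ := 8 * (B + 1) with hCdef
  have hC : 0 < C := by positivity
  have fresh : ∀ D : Finset E, OrthonormalImage T D →
      ∃ x : E, ‖x‖ ≤ C / 4 ∧ ‖T x‖ = 1 ∧ ∀ d ∈ D, inner ℝ (T d) (T x) = 0 := fun D hD => by
    obtain ⟨x, hx, h⟩ := exists_fresh_unit_vector hg hB hD
    exact ⟨x, hx.trans (by rw [hCdef]; linarith), h⟩
  let Good := {D : Finset E // OrthonormalImage T D ∧ ∀ x ∈ D, ‖x‖ ≤ C}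
  have step : ∀ (D : Good) (f : E), ∃ R : Good, D.1 ⊂ R.1 ∧ T f ∈ Submodule.span ℝ (T '' R.1) :=
    fun D f => by
      obtain ⟨R, h1, h2, h3, h4⟩ := exists_bounded_extension hC fresh D.2.1 D.2.2 f
      exact ⟨⟨R, h2, h3⟩, h1, h4⟩
  choose next hnext hspan using step
  let a : ℕ → E := TopologicalSpace.denseSeq E
  let S : ℕ → Good := fun n =>
    Nat.rec ⟨∅, by simp [OrthonormalImage], by simp⟩ (fun k D => next D (a k)) n
  have hSlt : StrictMono fun n => (S n).1 := strictMono_nat_of_lt_succ fun n => hnext (S n) (a n)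
  let U : Set E := ⋃ n, ((S n).1 : Set E)
  have hUc : U.Countable := Set.countable_iUnion fun n => (S n).1.countable_toSet
  have hUi : U.Infinite := fun hfin => by
    have h1 : ∀ n, (S n).1 ⊆ hfin.toFinset := fun n x hx =>
      hfin.mem_toFinset.2 (Set.mem_iUnion.2 ⟨n, hx⟩)
    have h2 : ∀ n, n ≤ (S n).1.card := by
      have : StrictMono fun n => (S n).1.card := fun i j hij => Finset.card_lt_card (hSlt hij)
      exact fun n => this.le_apply
    have h3 := Finset.card_le_card (h1 (hfin.toFinset.card + 1))
    have h4 := h2 (hfin.toFinset.card + 1)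
    omega
  have : Countable U := hUc.to_subtype
  have : Infinite U := hUi.to_subtype
  obtain ⟨ε⟩ : Nonempty (ℕ ≃ U) := ⟨(nonempty_denumerable U).some.eqv.symm⟩
  have hmem : ∀ n, ∃ k, (ε n : E) ∈ (S k).1 := fun n =>
    Set.mem_iUnion.1 (ε n).2
  have hpair : ∀ i j, ∃ k, (ε i : E) ∈ (S k).1 ∧ (ε j : E) ∈ (S k).1 := fun i j => by
    obtain ⟨k, hk⟩ := hmem i
    obtain ⟨l, hl⟩ := hmem j
    exact ⟨max k l, hSlt.monotone (le_max_left k l) hk, hSlt.monotone (le_max_right k l) hl⟩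
  refine ⟨C, fun n => ε n, fun n => ?_, ⟨fun n => ?_, fun i j hij => ?_⟩, fun f => ?_⟩
  · obtain ⟨k, hk⟩ := hmem n
    exact (S k).2.2 _ hk
  · obtain ⟨k, hk⟩ := hmem n
    exact (S k).2.1.1 _ hk
  · obtain ⟨k, hi, hj⟩ := hpair i j
    exact (S k).2.1.2 _ hi _ hj fun h => hij (ε.injective (Subtype.ext h))
  · have hclosed : IsClosed {x | T x ∈
        (Submodule.span ℝ (Set.range fun n => T (ε n))).topologicalClosure} :=
      (Submodule.isClosed_topologicalClosure _).preimage T.continuous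
    refine hclosed.closure_subset_iff.2 ?_ (TopologicalSpace.denseRange_denseSeq E f)
    rintro _ ⟨k, rfl⟩
    refine Submodule.le_topologicalClosure _ (Submodule.span_mono ?_ (hspan (S k) (a k)))
    rintro _ ⟨y, hy, rfl⟩
    have hyU : y ∈ U := Set.mem_iUnion.2 ⟨k + 1, hy⟩
    exact ⟨ε.symm ⟨y, hyU⟩, by simp⟩

end BoundedBasis

/-! ### Hölder functions on the symbolic space -/

noncomputable section

local notation "δ" => @dist BinSeq PiNat.dist

theorem binDist_nonneg (x y : BinSeq) : 0 ≤ δ x y := PiNat.dist_nonneg x y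

theorem binDist_rpow_nonneg (s : ℝ) (x y : BinSeq) : 0 ≤ δ x y ^ s :=
  Real.rpow_nonneg (binDist_nonneg x y) s

theorem binDist_le_iff {x y : BinSeq} {n : ℕ} :
    δ x y ≤ (1 / 2) ^ n ↔ ∀ k < n, x k = y k := by
  rw [PiNat.dist_comm, ← PiNat.mem_cylinder_iff_dist_le, PiNat.mem_cylinder_iff]
  exact forall₂_congr fun _ _ => eq_comm

theorem IsHolder.exists_nonneg {s : ℝ} {f : BinSeq → ℝ} (hf : IsHolder s f) :
    ∃ C, 0 ≤ C ∧ ∀ x y, |f x - f y| ≤ C * δ x y ^ s := by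
  obtain ⟨C, hC⟩ := hf
  exact ⟨|C|, abs_nonneg C, fun x y => (hC x y).trans
    (mul_le_mul_of_nonneg_right (le_abs_self C) (binDist_rpow_nonneg s x y))⟩

theorem IsHolder.bounded {s : ℝ} (hs : 0 < s) {f : BinSeq → ℝ} (hf : IsHolder s f) :
    ∃ M, 0 ≤ M ∧ ∀ x, |f x| ≤ M := by
  obtain ⟨C, hC0, hC⟩ := hf.exists_nonneg
  refine ⟨|f 0| + C, by positivity, fun x => ?_⟩
  have h1 : δ x 0 ^ s ≤ 1 :=
    Real.rpow_le_one (binDist_nonneg x 0) (PiNat.dist_le_one x 0) hs.le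
  have h2 := (hC x 0).trans (mul_le_of_le_one_right hC0 h1)
  have h3 := abs_sub_abs_le_abs_sub (f x) (f 0)
  linarith

theorem isHolder_const (s c : ℝ) : IsHolder s fun _ => c := ⟨0, fun x y => by simp⟩

theorem IsHolder.add {s : ℝ} {f g : BinSeq → ℝ} (hf : IsHolder s f) (hg : IsHolder s g) :
    IsHolder s fun x => f x + g x := by
  obtain ⟨C, hC⟩ := hf
  obtain ⟨D, hD⟩ := hg
  refine ⟨C + D, fun x y => ?_⟩
  rw [add_sub_add_comm, add_mul]
  exact (abs_add_le _ _).trans (add_le_add (hC x y) (hD x y))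

theorem IsHolder.mul {s : ℝ} (hs : 0 < s) {f g : BinSeq → ℝ} (hf : IsHolder s f)
    (hg : IsHolder s g) : IsHolder s fun x => f x * g x := by
  obtain ⟨M, hM0, hM⟩ := hf.bounded hs
  obtain ⟨N, hN0, hN⟩ := hg.bounded hs
  obtain ⟨C, hC0, hC⟩ := hf.exists_nonneg
  obtain ⟨D, hD0, hD⟩ := hg.exists_nonneg
  refine ⟨M * D + C * N, fun x y => ?_⟩
  have h : f x * g x - f y * g y = f x * (g x - g y) + (f x - f y) * g y := by ring
  rw [h]
  refine (abs_add_le _ _).trans ?_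
  rw [abs_mul, abs_mul, add_mul]
  refine add_le_add ?_ ?_
  · rw [mul_assoc]
    exact mul_le_mul (hM x) (hD x y) (abs_nonneg _) hM0
  · rw [mul_right_comm]
    exact mul_le_mul (hC x y) (hN y) (abs_nonneg _) (mul_nonneg hC0 (binDist_rpow_nonneg s x y))

theorem IsHolder.const_mul {s : ℝ} (hs : 0 < s) {f : BinSeq → ℝ} (c : ℝ) (hf : IsHolder s f) :
    IsHolder s fun x => c * f x :=
  (isHolder_const s c).mul hs hf

theorem IsHolder.sub {s : ℝ} (hs : 0 < s) {f g : BinSeq → ℝ} (hf : IsHolder s f)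
    (hg : IsHolder s g) : IsHolder s fun x => f x - g x := by
  simpa [sub_eq_add_neg] using hf.add (hg.const_mul hs (-1))

theorem IsHolder.exp {s : ℝ} (hs : 0 < s) {f : BinSeq → ℝ} (hf : IsHolder s f) :
    IsHolder s fun x => Real.exp (f x) := by
  obtain ⟨M, hM0, hM⟩ := hf.bounded hs
  obtain ⟨C, hC0, hC⟩ := hf.exists_nonneg
  have key : ∀ x y, Real.exp (f x) - Real.exp (f y) ≤ Real.exp M * C * δ x y ^ s := by
    intro x y
    have h1 : Real.exp (f y) = Real.exp (f x) * Real.exp (f y - f x) := by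
      rw [← Real.exp_add]; congr 1; ring
    have h2 := Real.add_one_le_exp (f y - f x)
    calc Real.exp (f x) - Real.exp (f y) = Real.exp (f x) * (1 - Real.exp (f y - f x)) := by
          rw [h1]; ring
      _ ≤ Real.exp (f x) * |f x - f y| :=
          mul_le_mul_of_nonneg_left (by linarith [le_abs_self (f x - f y)]) (Real.exp_pos _).le
      _ ≤ Real.exp M * (C * δ x y ^ s) :=
          mul_le_mul (Real.exp_le_exp.2 ((le_abs_self _).trans (hM x))) (hC x y)
            (abs_nonneg _) (Real.exp_pos _).le
      _ = _ := by ring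
  refine ⟨Real.exp M * C, fun x y => abs_sub_le_iff.2 ⟨key x y, ?_⟩⟩
  rw [PiNat.dist_comm]
  exact key y x

/-- A map that shifts the first difference of two sequences down by at most one index is
`2`-Lipschitz, so composition with it preserves Hölder continuity. -/
theorem IsHolder.comp_of_agree {s : ℝ} (hs : 0 < s) {f : BinSeq → ℝ} (hf : IsHolder s f)
    {F : BinSeq → BinSeq}
    (hF : ∀ n x y, (∀ k < n + 1, x k = y k) → ∀ k < n, F x k = F y k) :
    IsHolder s fun x => f (F x) := by
  obtain ⟨C, hC0, hC⟩ := hf.exists_nonneg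
  have hlip : ∀ x y, δ (F x) (F y) ≤ 2 * δ x y := by
    intro x y
    by_cases hxy : x = y
    · rw [hxy, PiNat.dist_self, PiNat.dist_self, mul_zero]
    have hd := PiNat.dist_eq_of_ne hxy
    cases hn : PiNat.firstDiff x y with
    | zero =>
      rw [hn, pow_zero] at hd
      have := PiNat.dist_le_one (F x) (F y)
      rw [hd]; linarith
    | succ n =>
      rw [hn] at hd
      have h1 : δ (F x) (F y) ≤ (1 / 2) ^ n :=
        binDist_le_iff.2 (hF n x y (binDist_le_iff.1 hd.le))
      rw [hd, pow_succ]
      linarith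
  refine ⟨C * 2 ^ s, fun x y => (hC _ _).trans ?_⟩
  rw [mul_assoc, ← Real.mul_rpow two_pos.le (binDist_nonneg x y)]
  exact mul_le_mul_of_nonneg_left
    (Real.rpow_le_rpow (binDist_nonneg _ _) (hlip x y) hs.le) hC0

theorem IsHolder.comp_binCons {s : ℝ} (hs : 0 < s) {f : BinSeq → ℝ} (hf : IsHolder s f)
    (i : Fin 2) : IsHolder s fun x => f (binCons i x) := by
  refine hf.comp_of_agree hs fun n x y h k hk => ?_
  cases k with
  | zero => rfl
  | succ k => exact h k (by omega)

theorem IsHolder.comp_binShift {s : ℝ} (hs : 0 < s) {f : BinSeq → ℝ} (hf : IsHolder s f) :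
    IsHolder s fun x => f (binShift x) :=
  hf.comp_of_agree hs fun _ _ _ h k hk => h (k + 1) (by omega)

theorem isHolder_of_agree {s : ℝ} (hs : 0 < s) {f : BinSeq → ℝ} (n : ℕ) {M : ℝ}
    (hM : ∀ x, |f x| ≤ M) (hf : ∀ x y, (∀ k < n, x k = y k) → f x = f y) : IsHolder s f := by
  have hM0 : 0 ≤ M := (abs_nonneg _).trans (hM 0)
  refine ⟨2 * M / ((1 / 2) ^ n) ^ s, fun x y => ?_⟩
  have hp : (0 : ℝ) < ((1 / 2) ^ n) ^ s := Real.rpow_pos_of_pos (by positivity) s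
  by_cases h : ∀ k < n, x k = y k
  · rw [hf x y h, sub_self, abs_zero]
    exact mul_nonneg (by positivity) (binDist_rpow_nonneg s x y)
  · have h1 : (1 / 2 : ℝ) ^ n ≤ δ x y := (not_le.1 (mt binDist_le_iff.1 h)).le
    have h2 : ((1 / 2 : ℝ) ^ n) ^ s ≤ δ x y ^ s := Real.rpow_le_rpow (by positivity) h1 hs.le
    have h3 : |f x - f y| ≤ 2 * M := by
      have := abs_sub (f x) (f y)
      linarith [hM x, hM y]
    rw [div_mul_eq_mul_div, le_div_iff₀ hp]
    exact mul_le_mul h3 h2 hp.le (by positivity)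

theorem isHolder_coord {s : ℝ} (hs : 0 < s) (n : ℕ) (v : Fin 2 → ℝ) :
    IsHolder s fun x : BinSeq => v (x n) := by
  refine isHolder_of_agree hs (n + 1) (M := |v 0| + |v 1|) (fun x => ?_) fun x y h => ?_
  · match x n with
    | 0 => exact le_add_of_nonneg_right (abs_nonneg _)
    | 1 => exact le_add_of_nonneg_left (abs_nonneg _)
  · rw [h n n.lt_succ_self]

/-- The Hölder continuous functions of exponent `s`, as a subalgebra of `C(BinSeq, ℝ)`. -/
def holderSubalgebra (s : ℝ) (hs : 0 < s) : Subalgebra ℝ C(BinSeq, ℝ) where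
  carrier := {f | IsHolder s f}
  mul_mem' hf hg := hf.mul hs hg
  add_mem' hf hg := hf.add hg
  algebraMap_mem' c := isHolder_const s c

theorem dense_holderSubalgebra (s : ℝ) (hs : 0 < s) :
    Dense (holderSubalgebra s hs : Set C(BinSeq, ℝ)) := by
  have h := ContinuousMap.subalgebra_topologicalClosure_eq_top_of_separatesPoints
    (holderSubalgebra s hs) (fun x y hxy => by
      obtain ⟨n, hn⟩ := Function.ne_iff.1 hxy
      have hc := isHolder_coord hs n fun i => ((i : ℕ) : ℝ)
      refine ⟨_, ⟨⟨_, hc.continuous hs⟩, hc, rfl⟩, ?_⟩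
      exact fun h => hn (Fin.ext (Nat.cast_injective h)))
  rw [dense_iff_closure_eq, ← Subalgebra.topologicalClosure_coe, h]
  rfl

theorem continuous_binShift : Continuous binShift :=
  continuous_pi fun n => continuous_apply (n + 1)

/-- Composition with the shift, `h ↦ h ∘ σ`. -/
def compShift (h : C(BinSeq, ℝ)) : C(BinSeq, ℝ) := h.comp ⟨binShift, continuous_binShift⟩

@[simp] theorem compShift_apply (h : C(BinSeq, ℝ)) (x : BinSeq) :
    compShift h x = h (binShift x) := rfl

theorem ruelle_compShift_mul (A : BinSeq → ℝ) (h f : BinSeq → ℝ) (x : BinSeq) :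
    ruelle A (fun y => h (binShift y) * f y) x = h x * ruelle A f x := by
  have hs : ∀ i, binShift (binCons i x) = x := fun _ => rfl
  simp only [ruelle_apply, hs]
  ring

theorem IsNormalized.weight_add {A : BinSeq → ℝ} (hnorm : IsNormalized A) (x : BinSeq) :
    Real.exp (A (binCons 0 x)) + Real.exp (A (binCons 1 x)) = 1 := by
  simpa [ruelle_apply] using hnorm x

theorem IsHolder.ruelle {s : ℝ} (hs : 0 < s) {A f : BinSeq → ℝ} (hA : IsHolder s A)
    (hf : IsHolder s f) : IsHolder s (ruelle A f) := by
  have h : ∀ i, IsHolder s fun x => Real.exp (A (binCons i x)) * f (binCons i x) := fun i =>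
    ((hA.exp hs).mul hs hf).comp_binCons hs i
  have := (h 0).add (h 1)
  simpa only [← ruelle_apply] using this

/-! ### The tangent space -/

/-- The tangent space `T_A N` as a linear subspace of `C(BinSeq, ℝ)`. -/
def tangentSubmodule (s : ℝ) (hs : 0 < s) (A : BinSeq → ℝ) : Submodule ℝ C(BinSeq, ℝ) where
  carrier := {f | ⇑f ∈ tangentSpaceAt s A}
  add_mem' {f g} hf hg := ⟨hf.1.add hg.1, fun x => by
    have h1 := hf.2 x
    have h2 := hg.2 x
    rw [ruelle_apply] at h1 h2 ⊢
    simp only [ContinuousMap.add_apply]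
    linear_combination h1 + h2⟩
  zero_mem' := ⟨isHolder_const s 0, fun x => by simp [ruelle_apply]⟩
  smul_mem' c f hf := ⟨hf.1.const_mul hs c, fun x => by
    have h1 := hf.2 x
    rw [ruelle_apply] at h1 ⊢
    simp only [ContinuousMap.smul_apply, smul_eq_mul]
    linear_combination c * h1⟩

/-- `f - (L_A f) ∘ σ` lies in the tangent space: since `L_A ((h ∘ σ) * f) = h * L_A f` and
`L_A 1 = 1`, the map `f ↦ f - (L_A f) ∘ σ` is a projection onto the kernel of `L_A`. -/
theorem sub_ruelle_comp_shift_mem {s : ℝ} (hs : 0 < s) {A : BinSeq → ℝ} (hA : IsHolder s A)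
    (hnorm : IsNormalized A) {f : BinSeq → ℝ} (hf : IsHolder s f) :
    (fun x => f x - ruelle A f (binShift x)) ∈ tangentSpaceAt s A := by
  refine ⟨hf.sub hs ((hA.ruelle hs hf).comp_binShift hs), fun x => ?_⟩
  have hsh : ∀ i, binShift (binCons i x) = x := fun _ => rfl
  have h1 := hnorm.weight_add x
  have h2 := ruelle_apply A f x
  rw [ruelle_apply]
  simp only [hsh]
  linear_combination (- ruelle A f x) * h1 - h2

/-- The function `φ` with `φ(0x) = e^{(A(1x) - A(0x)) / 2}` and `φ(1x) = -e^{(A(0x) - A(1x)) / 2}`,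
which satisfies `L_A φ = 0` and `L_A (φ²) = 1`. -/
def kernelUnit (A : BinSeq → ℝ) (x : BinSeq) : ℝ :=
  (if x 0 = 0 then 1 else -1) *
    Real.exp ((A (binCons 0 (binShift x)) + A (binCons 1 (binShift x))) / 2 - A x)

theorem isHolder_kernelUnit {s : ℝ} (hs : 0 < s) {A : BinSeq → ℝ} (hA : IsHolder s A) :
    IsHolder s (kernelUnit A) := by
  have h0 := (hA.comp_binCons hs 0).comp_binShift hs
  have h1 := (hA.comp_binCons hs 1).comp_binShift hs
  have h2 := (((h0.add h1).const_mul hs (1 / 2)).sub hs hA).exp hs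
  have h3 := isHolder_coord hs 0 fun i : Fin 2 => if i = 0 then (1 : ℝ) else -1
  have h4 := h3.mul hs h2
  simp only [one_div_mul_eq_div] at h4
  exact h4

theorem ruelle_kernelUnit (A : BinSeq → ℝ) (x : BinSeq) : ruelle A (kernelUnit A) x = 0 := by
  have hs : ∀ i, binShift (binCons i x) = x := fun _ => rfl
  have h0 : ∀ i, binCons i x 0 = i := fun _ => rfl
  simp only [ruelle_apply, kernelUnit, hs, h0, Real.exp_sub]
  field_simp
  simp

theorem ruelle_kernelUnit_sq {A : BinSeq → ℝ} (hnorm : IsNormalized A) (x : BinSeq) :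
    ruelle A (fun y => kernelUnit A y * kernelUnit A y) x = 1 := by
  have hs : ∀ i, binShift (binCons i x) = x := fun _ => rfl
  have h0 : ∀ i, binCons i x 0 = i := fun _ => rfl
  have h1 := hnorm.weight_add x
  have key : ∀ i : Fin 2, (kernelUnit A (binCons i x)) * (kernelUnit A (binCons i x))
      = Real.exp (A (binCons 0 x) + A (binCons 1 x) - A (binCons i x) - A (binCons i x)) := by
    intro i
    have : (if i = 0 then (1 : ℝ) else -1) * (if i = 0 then (1 : ℝ) else -1) = 1 := by
      split_ifs <;> norm_num
    rw [kernelUnit, mul_mul_mul_comm, h0, this, one_mul, ← Real.exp_add, hs]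
    congr 1; ring
  rw [ruelle_apply, key, key, ← Real.exp_add, ← Real.exp_add, ← h1, add_comm]
  congr 2 <;> ring

end

/-! ### The Ruelle operator on `L²(μ)` -/

noncomputable section

variable {A : BinSeq → ℝ} {μ : Measure BinSeq} [IsProbabilityMeasure μ]

theorem ContinuousMap.integrable_binSeq (f : C(BinSeq, ℝ)) : Integrable f μ :=
  (BoundedContinuousFunction.mkOfCompact f).integrable μ

/-- The measure `μ` is the sum of the images, under the two inverse branches of the shift, of
`μ` weighted by `e^A`: this is `L_A^* μ = μ` in terms of measures. -/
theorem IsEquilibrium.eq_sum_map (hA : Continuous A) (hμ : IsEquilibrium A μ) :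
    (μ.withDensity fun x => ENNReal.ofReal (Real.exp (A (binCons 0 x)))).map (binCons 0)
      + (μ.withDensity fun x => ENNReal.ofReal (Real.exp (A (binCons 1 x)))).map (binCons 1)
      = μ := by
  have hw : ∀ i, Continuous fun x => Real.exp (A (binCons i x)) := fun i =>
    Real.continuous_exp.comp (hA.comp (continuous_binCons i))
  let w : Fin 2 → BinSeq → ENNReal := fun i x => ENNReal.ofReal (Real.exp (A (binCons i x)))
  have hwm : ∀ i, Measurable (w i) := fun i => (hw i).measurable.ennreal_ofReal
  have hfin : ∀ i, IsFiniteMeasure (μ.withDensity (w i)) := fun i =>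
    isFiniteMeasure_withDensity_ofReal (ContinuousMap.integrable_binSeq ⟨_, hw i⟩).2
  have hcm : ∀ i, Measurable (binCons i) := fun i => (continuous_binCons i).measurable
  change ((μ.withDensity (w 0)).map (binCons 0) + (μ.withDensity (w 1)).map (binCons 1)) = μ
  refine ext_of_forall_integral_eq_of_IsFiniteMeasure fun φ => ?_
  have e : ∀ i, ∫ x, φ x ∂((μ.withDensity (w i)).map (binCons i))
      = ∫ x, Real.exp (A (binCons i x)) * φ (binCons i x) ∂μ := by
    intro i
    rw [integral_map (hcm i).aemeasurable φ.continuous.aestronglyMeasurable,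
      integral_withDensity_eq_integral_toReal_smul (hwm i)
        (Filter.Eventually.of_forall fun _ => ENNReal.ofReal_lt_top)]
    simp [w, ENNReal.toReal_ofReal, (Real.exp_pos _).le]
  have hi : ∀ i, Integrable (fun x => Real.exp (A (binCons i x)) * φ (binCons i x)) μ := fun i =>
    ContinuousMap.integrable_binSeq ⟨_, (hw i).mul (φ.continuous.comp (continuous_binCons i))⟩
  rw [integral_add_measure (φ.integrable _) (φ.integrable _), e 0, e 1,
    ← integral_add (hi 0) (hi 1), ← show _ = ∫ x, φ x ∂μ from hμ.dual_eq φ.toContinuousMap]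
  simp only [ruelle_apply]
  rfl

/-- The identity `∫ L_A f dμ = ∫ f dμ` extends from continuous to integrable functions. -/
theorem IsEquilibrium.integral_ruelle (hA : Continuous A) (hμ : IsEquilibrium A μ)
    {f : BinSeq → ℝ} (hf : Integrable f μ) :
    Integrable (ruelle A f) μ ∧ ∫ x, ruelle A f x ∂μ = ∫ x, f x ∂μ := by
  have hw : ∀ i, Continuous fun x => Real.exp (A (binCons i x)) := fun i =>
    Real.continuous_exp.comp (hA.comp (continuous_binCons i))
  let w : Fin 2 → BinSeq → ENNReal := fun i x => ENNReal.ofReal (Real.exp (A (binCons i x)))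
  have hwm : ∀ i, Measurable (w i) := fun i => (hw i).measurable.ennreal_ofReal
  have hwt : ∀ i, ∀ᵐ x ∂μ, w i x < ⊤ := fun i =>
    Filter.Eventually.of_forall fun _ => ENNReal.ofReal_lt_top
  have hcm : ∀ i, Measurable (binCons i) := fun i => (continuous_binCons i).measurable
  let m : Fin 2 → Measure BinSeq := fun i => (μ.withDensity (w i)).map (binCons i)
  have hsum : m 0 + m 1 = μ := hμ.eq_sum_map hA
  have hfm : ∀ i, Integrable f (m i) := by
    rw [← hsum] at hf
    intro i
    match i with
    | 0 => exact hf.left_of_add_measure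
    | 1 => exact hf.right_of_add_measure
  have hwi : ∀ i x, (w i x).toReal = Real.exp (A (binCons i x)) := fun i x =>
    ENNReal.toReal_ofReal (Real.exp_pos _).le
  have hint : ∀ i, Integrable (fun x => Real.exp (A (binCons i x)) * f (binCons i x)) μ := by
    intro i
    have h1 := (integrable_map_measure (hfm i).1 (hcm i).aemeasurable).1 (hfm i)
    rw [integrable_withDensity_iff_integrable_smul' (hwm i) (hwt i)] at h1
    simpa only [hwi, smul_eq_mul, Function.comp_apply] using h1
  have heq : ∀ i, ∫ x, f x ∂(m i) = ∫ x, Real.exp (A (binCons i x)) * f (binCons i x) ∂μ := by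
    intro i
    rw [integral_map (hcm i).aemeasurable (hfm i).1,
      integral_withDensity_eq_integral_toReal_smul (hwm i) (hwt i)]
    simp only [hwi, smul_eq_mul]
  have hR : ruelle A f = fun x => Real.exp (A (binCons 0 x)) * f (binCons 0 x)
      + Real.exp (A (binCons 1 x)) * f (binCons 1 x) := funext (ruelle_apply A f)
  rw [hR]
  refine ⟨(hint 0).add (hint 1), ?_⟩
  rw [integral_add (hint 0) (hint 1), ← heq, ← heq,
    ← integral_add_measure (hfm 0) (hfm 1), hsum]

/-- The operator `L_A` is the adjoint of `h ↦ h ∘ σ`. -/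
theorem IsEquilibrium.integral_comp_shift_mul (hA : Continuous A) (hμ : IsEquilibrium A μ)
    (h : C(BinSeq, ℝ)) {f : BinSeq → ℝ} (hf : Integrable f μ) :
    ∫ x, h (binShift x) * f x ∂μ = ∫ x, h x * ruelle A f x ∂μ := by
  have hi : Integrable (fun x => h (binShift x) * f x) μ :=
    hf.bdd_mul (compShift h).continuous.aestronglyMeasurable
      (Filter.Eventually.of_forall fun x => (compShift h).norm_coe_le_norm x)
  rw [← (hμ.integral_ruelle hA hi).2]
  exact integral_congr_ae (Filter.Eventually.of_forall (ruelle_compShift_mul A h f))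

theorem inner_toLp_left (h : C(BinSeq, ℝ)) (f : Lp ℝ 2 μ) :
    inner ℝ (ContinuousMap.toLp (E := ℝ) 2 μ ℝ h) f = ∫ x, h x * f x ∂μ := by
  rw [L2.inner_def]
  refine integral_congr_ae ?_
  filter_upwards [ContinuousMap.coeFn_toLp (E := ℝ) (p := 2) (𝕜 := ℝ) μ h] with x hx
  rw [hx, real_inner_eq_re_inner]
  simp [mul_comm]

theorem inner_toLp_toLp (h f : C(BinSeq, ℝ)) :
    inner ℝ (ContinuousMap.toLp (E := ℝ) 2 μ ℝ h) (ContinuousMap.toLp (E := ℝ) 2 μ ℝ f)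
      = ∫ x, h x * f x ∂μ := by
  rw [inner_toLp_left]
  refine integral_congr_ae ?_
  filter_upwards [ContinuousMap.coeFn_toLp (E := ℝ) (p := 2) (𝕜 := ℝ) μ f] with x hx
  rw [hx]

/-- Jensen's inequality `(L_A f)² ≤ L_A (f²)` makes `L_A` act on `L²(μ)`. -/
theorem IsEquilibrium.memLp_ruelle (hA : Continuous A) (hnorm : IsNormalized A)
    (hμ : IsEquilibrium A μ) {f : BinSeq → ℝ} (hf : MemLp f 2 μ) : MemLp (ruelle A f) 2 μ := by
  have h1 := (hμ.integral_ruelle hA (hf.integrable one_le_two)).1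
  have h2 := (hμ.integral_ruelle hA hf.integrable_sq).1
  rw [memLp_two_iff_integrable_sq h1.1]
  refine h2.mono' (h1.1.pow 2) (Filter.Eventually.of_forall fun x => ?_)
  rw [Real.norm_of_nonneg (sq_nonneg _), ruelle_apply, ruelle_apply]
  have h3 := hnorm.weight_add x
  have h4 := mul_pos (Real.exp_pos (A (binCons 0 x))) (Real.exp_pos (A (binCons 1 x)))
  have h5 := mul_nonneg h4.le (sq_nonneg (f (binCons 0 x) - f (binCons 1 x)))
  have h6 : Real.exp (A (binCons 1 x)) = 1 - Real.exp (A (binCons 0 x)) := by linarith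
  rw [h6] at h5 ⊢
  linarith

theorem IsEquilibrium.mem_ruelleKernel_iff (hA : Continuous A) (hnorm : IsNormalized A)
    (hμ : IsEquilibrium A μ) (f : Lp ℝ 2 μ) :
    f ∈ ruelleKernel A μ ↔
      ∀ h : C(BinSeq, ℝ), inner ℝ (ContinuousMap.toLp (E := ℝ) 2 μ ℝ (compShift h)) f = 0 := by
  have hf : MemLp f 2 μ := Lp.memLp f
  have key : ∀ h : C(BinSeq, ℝ), inner ℝ (ContinuousMap.toLp (E := ℝ) 2 μ ℝ (compShift h)) f
      = ∫ x, h x * ruelle A f x ∂μ := fun h => by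
    rw [inner_toLp_left]
    exact hμ.integral_comp_shift_mul hA h (hf.integrable one_le_two)
  constructor
  · intro hk h
    rw [key]
    have hk' : ruelle A f =ᵐ[μ] 0 := hk
    refine integral_eq_zero_of_ae ?_
    filter_upwards [hk'] with x hx
    simp [hx]
  · intro hk
    have hL := hμ.memLp_ruelle hA hnorm hf
    have h0 : hL.toLp = 0 := by
      refine (ContinuousMap.toLp_denseRange ℝ μ ℝ (p := 2) (by simp)).eq_zero_of_inner_right ℝ
        fun h => ?_
      rw [inner_toLp_left, ← hk h, key]
      refine integral_congr_ae ?_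
      filter_upwards [hL.coeFn_toLp] with x hx
      rw [hx]
    have h1 := hL.coeFn_toLp
    rw [h0] at h1
    exact h1.symm.trans (Lp.coeFn_zero ℝ 2 μ)

/-- The kernel of `L_A` on `L²(μ)` as a linear subspace: the orthogonal complement of the
functions `h ∘ σ`. -/
def ruelleKernelSubmodule (μ : Measure BinSeq) [IsProbabilityMeasure μ] :
    Submodule ℝ (Lp ℝ 2 μ) :=
  (Submodule.span ℝ (Set.range fun h : C(BinSeq, ℝ) =>
    ContinuousMap.toLp (E := ℝ) 2 μ ℝ (compShift h)))ᗮ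

theorem IsEquilibrium.coe_ruelleKernelSubmodule (hA : Continuous A) (hnorm : IsNormalized A)
    (hμ : IsEquilibrium A μ) : (ruelleKernelSubmodule μ : Set (Lp ℝ 2 μ)) = ruelleKernel A μ := by
  ext f
  rw [hμ.mem_ruelleKernel_iff hA hnorm, SetLike.mem_coe, ruelleKernelSubmodule,
    Submodule.mem_orthogonal]
  constructor
  · exact fun h u => h _ (Submodule.subset_span ⟨u, rfl⟩)
  · intro h u hu
    induction hu using Submodule.span_induction with
    | mem x hx => obtain ⟨g, rfl⟩ := hx; exact h g
    | zero => exact inner_zero_left _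
    | add x y _ _ hx hy => rw [inner_add_left, hx, hy, add_zero]
    | smul c x _ hx => rw [inner_smul_left, hx, mul_zero]

/-- A closed subspace of the kernel of `L_A` that contains the Hölder functions of the kernel is
the whole kernel: a vector `f` of the kernel is orthogonal to `(L_A g) ∘ σ`, so if it is orthogonal
to `g - (L_A g) ∘ σ` for all Hölder `g`, it is orthogonal to a dense set. -/
theorem IsEquilibrium.eq_ruelleKernelSubmodule {s : ℝ} (hs : 0 < s) (hA : IsHolder s A)
    (hnorm : IsNormalized A) {W : Submodule ℝ (Lp ℝ 2 μ)} (hWc : IsClosed (W : Set (Lp ℝ 2 μ)))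
    (hW : W ≤ ruelleKernelSubmodule μ)
    (hV : ∀ f ∈ tangentSubmodule s hs A, ContinuousMap.toLp (E := ℝ) 2 μ ℝ f ∈ W) :
    W = ruelleKernelSubmodule μ := by
  have : CompleteSpace W := hWc.completeSpace_coe
  rw [← Submodule.sup_orthogonal_inf_of_hasOrthogonalProjection hW, left_eq_sup]
  rintro f ⟨hfW, hfK⟩
  suffices f = 0 by rw [this]; exact W.zero_mem
  have hd := (ContinuousMap.toLp_denseRange ℝ μ ℝ (p := 2) (by simp)).dense_image
    (ContinuousMap.toLp (E := ℝ) 2 μ ℝ).continuous (dense_holderSubalgebra s hs)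
  refine hd.eq_zero_of_inner_right ℝ ?_
  rintro _ ⟨g, hg, rfl⟩
  have hLg := hA.ruelle hs hg
  let u : C(BinSeq, ℝ) := ⟨ruelle A g, hLg.continuous hs⟩
  have hmem : g - compShift u ∈ tangentSubmodule s hs A :=
    sub_ruelle_comp_shift_mem hs hA hnorm hg
  have h1 := hfW _ (hV _ hmem)
  have h2 : inner ℝ (ContinuousMap.toLp (E := ℝ) 2 μ ℝ (compShift u)) f = 0 :=
    hfK _ (Submodule.subset_span ⟨u, rfl⟩)
  rwa [map_sub, inner_sub_left, h2, sub_zero] at h1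

/-- Correlations of the functions `φ ∘ σ ^ m`. -/
theorem IsEquilibrium.integral_iterate_mul {φ : C(BinSeq, ℝ)} (hA : Continuous A)
    (hnorm : IsNormalized A) (hμ : IsEquilibrium A μ) (h0 : ∀ x, ruelle A φ x = 0)
    (h1 : ∀ x, ruelle A (fun y => φ y * φ y) x = 1) (m k : ℕ) :
    ∫ x, (compShift^[m] φ) x * (compShift^[k] φ) x ∂μ = if m = k then 1 else 0 := by
  have hlt : ∀ k : ℕ, ∫ x, (compShift^[k + 1] φ) x * φ x ∂μ = 0 := fun k => by
    simp only [Function.iterate_succ_apply', compShift_apply]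
    rw [hμ.integral_comp_shift_mul hA _ φ.integrable_binSeq]
    simp [h0]
  induction m generalizing k with
  | zero =>
    cases k with
    | zero =>
      have := hμ.dual_eq (φ * φ)
      simp only [ContinuousMap.coe_mul, ContinuousMap.mul_apply] at this
      rw [if_pos rfl]
      refine this.symm.trans ?_
      have h2 : ruelle A (⇑φ * ⇑φ) = fun _ => 1 := funext h1
      simp [h2]
    | succ k =>
      rw [if_neg (by omega), ← hlt k]
      simp only [mul_comm, Function.iterate_zero, id_eq]
  | succ m ih =>
    cases k with
    | zero => rw [if_neg (by omega)]; exact hlt m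
    | succ k =>
      simp only [Nat.add_right_cancel_iff, ← ih k]
      have h2 := hμ.integral_comp_shift_mul hA ((compShift^[m] φ) * (compShift^[k] φ))
        (f := fun _ => 1) (integrable_const 1)
      simp only [hnorm _, mul_one, ContinuousMap.mul_apply] at h2
      simpa only [Function.iterate_succ_apply', compShift_apply] using h2

/-- The products `φ * φ ∘ σ ^ (m + 1)`, with `φ = kernelUnit A`, form a uniformly bounded
orthonormal sequence in the tangent space: `L_A (φ² * h ∘ σ) = h` makes `h ↦ φ * h ∘ σ` an isometry
from `L²(μ)` into the kernel, and the functions `φ ∘ σ ^ m` are orthonormal because `L_A φ = 0`. -/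
theorem IsEquilibrium.exists_bounded_orthonormal {s : ℝ} (hs : 0 < s) (hA : IsHolder s A)
    (hnorm : IsNormalized A) (hμ : IsEquilibrium A μ) :
    ∃ (B : ℝ) (g : ℕ → tangentSubmodule s hs A), (∀ m, ‖g m‖ ≤ B) ∧
      Orthonormal ℝ fun m => ContinuousMap.toLp (E := ℝ) 2 μ ℝ (g m : C(BinSeq, ℝ)) := by
  have hAc := hA.continuous hs
  have hφ := isHolder_kernelUnit hs hA
  let φ : C(BinSeq, ℝ) := ⟨kernelUnit A, hφ.continuous hs⟩
  have h0 : ∀ x, ruelle A φ x = 0 := ruelle_kernelUnit A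
  have h1 : ∀ x, ruelle A (fun y => φ y * φ y) x = 1 := ruelle_kernelUnit_sq hnorm
  let u : ℕ → C(BinSeq, ℝ) := fun m => compShift^[m] φ
  have hu : ∀ m, IsHolder s (u m) ∧ ‖u m‖ ≤ ‖φ‖ := fun m => by
    induction m with
    | zero => exact ⟨hφ, le_rfl⟩
    | succ m ih =>
      have h2 : u (m + 1) = compShift (u m) := Function.iterate_succ_apply' _ _ _
      rw [h2]
      refine ⟨ih.1.comp_binShift hs, (ContinuousMap.norm_le _ (norm_nonneg _)).2 fun x => ?_⟩
      exact ((u m).norm_coe_le_norm _).trans ih.2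
  have hmem : ∀ m, compShift (u m) * φ ∈ tangentSubmodule s hs A := fun m =>
    ⟨((hu m).1.comp_binShift hs).mul hs hφ, fun x => by
      have := ruelle_compShift_mul A (u m) φ x
      rw [h0, mul_zero] at this
      exact this⟩
  have hin : ∀ m k, inner ℝ (ContinuousMap.toLp (E := ℝ) 2 μ ℝ (compShift (u m) * φ))
      (ContinuousMap.toLp (E := ℝ) 2 μ ℝ (compShift (u k) * φ)) = if m = k then (1 : ℝ) else 0 := by
    intro m k
    rw [inner_toLp_toLp, ← hμ.integral_iterate_mul hAc hnorm h0 h1 m k]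
    have h2 := hμ.integral_comp_shift_mul hAc (u m * u k) (φ * φ).integrable_binSeq
    have h3 : ruelle A ⇑(φ * φ) = fun _ => 1 := funext h1
    rw [h3] at h2
    simp only [mul_one, ContinuousMap.mul_apply] at h2
    refine Eq.trans ?_ h2
    refine integral_congr_ae (Filter.Eventually.of_forall fun x => ?_)
    simp only [ContinuousMap.mul_apply, compShift_apply]
    ring
  refine ⟨‖φ‖ * ‖φ‖, fun m => ⟨_, hmem m⟩, fun m => ?_, orthonormal_iff_ite.2 hin⟩
  refine (ContinuousMap.norm_le _ (by positivity)).2 fun x => ?_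
  change ‖compShift (u m) x * φ x‖ ≤ _
  rw [norm_mul]
  exact mul_le_mul (((u m).norm_coe_le_norm _).trans (hu m).2) (φ.norm_coe_le_norm x)
    (norm_nonneg _) (norm_nonneg _)

end

theorem lemma3p3 (s : ℝ) (hs : 0 < s) (A : BinSeq → ℝ) (hA : IsHolder s A)
    (hnorm : IsNormalized A) (μ : MeasureTheory.Measure BinSeq)
    [MeasureTheory.IsProbabilityMeasure μ] (hμ : IsEquilibrium A μ) :
    ∃ α β : ℝ, 0 < α ∧ 0 < β ∧ ∃ e : ℕ → C(BinSeq, ℝ),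
      (∀ n, ⇑(e n) ∈ tangentSpaceAt s A) ∧
      Orthonormal ℝ (fun n => ContinuousMap.toLp (E := ℝ) 2 μ ℝ (e n)) ∧
      ((Submodule.span ℝ (Set.range fun n =>
          ContinuousMap.toLp (E := ℝ) 2 μ ℝ (e n))).topologicalClosure :
            Set (MeasureTheory.Lp ℝ 2 μ)) = ruelleKernel A μ ∧
      ∀ n, (α ≤ ‖e n‖ ∧ ‖e n‖ ≤ β) ∧
        (α ≤ ‖ContinuousMap.toLp (E := ℝ) 2 μ ℝ (e n)‖ ∧
          ‖ContinuousMap.toLp (E := ℝ) 2 μ ℝ (e n)‖ ≤ β) := by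
  have hAc := hA.continuous hs
  obtain ⟨B, g, hgB, hg⟩ := hμ.exists_bounded_orthonormal hs hA hnorm
  let T : tangentSubmodule s hs A →L[ℝ] Lp ℝ 2 μ :=
    (ContinuousMap.toLp (E := ℝ) 2 μ ℝ).comp (tangentSubmodule s hs A).subtypeL
  have hT : ∀ f, T f = ContinuousMap.toLp (E := ℝ) 2 μ ℝ (f : C(BinSeq, ℝ)) := fun _ => rfl
  -- Only `hT` is needed from here on; an opaque `T` keeps unification cheap.
  clear_value T
  simp only [← hT] at hg
  obtain ⟨C, e, heC, heo, hspan⟩ := exists_bounded_orthonormal_basis hg hgB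
  simp only [hT] at heo hspan
  -- The `L²` norm is at most the sup norm because `μ` is a probability measure.
  have hle : ∀ f : C(BinSeq, ℝ), ‖ContinuousMap.toLp (E := ℝ) 2 μ ℝ f‖ ≤ ‖f‖ := fun f => by
    have h := (ContinuousMap.toLp (E := ℝ) 2 μ ℝ).le_of_opNorm_le
      (ContinuousMap.toLp_norm_le (p := 2) (μ := μ) (E := ℝ) (𝕜 := ℝ)) f
    simpa [measureUnivNNReal] using h
  have hC : 1 ≤ C := (heo.1 0).symm.le.trans ((hle _).trans (heC 0))
  refine ⟨1, C, one_pos, by linarith, fun n => e n, fun n => (e n).2, heo, ?_, fun n => ?_⟩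
  · rw [← hμ.coe_ruelleKernelSubmodule hAc hnorm]
    refine SetLike.coe_set_eq.2 (IsEquilibrium.eq_ruelleKernelSubmodule hs hA hnorm
      (Submodule.isClosed_topologicalClosure _) ?_ fun f hf => hspan ⟨f, hf⟩)
    refine Submodule.topologicalClosure_minimal _ (Submodule.span_le.2 ?_)
      (Submodule.isClosed_orthogonal _)
    rintro _ ⟨n, rfl⟩
    rw [hμ.coe_ruelleKernelSubmodule hAc hnorm]
    refine (ruelle_congr_ae hAc hμ (ContinuousMap.coeFn_toLp (E := ℝ) (p := 2) (𝕜 := ℝ) μ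
      (e n : C(BinSeq, ℝ)))).trans ?_
    exact Filter.Eventually.of_forall (e n).2.2
  · have h1 : ‖ContinuousMap.toLp (E := ℝ) 2 μ ℝ (e n : C(BinSeq, ℝ))‖ = 1 := heo.1 n
    exact ⟨⟨h1.symm.le.trans (hle _), heC n⟩, h1.symm.le, h1.le.trans hC⟩
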